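/- Let $L_2(\mathbb{R})$ be the space of real-valued, or of complex-valued, square-integrable functions on $\mathbb{R}$ (the scalars are $\mathbb{R}$ or $\mathbb{C}$ accordingly). Let $0<\rho\leqslant\sigma$, $B\in L_2(\mathbb{R})$, and suppose that the shifts $B(\cdot-\frac{j\pi}{\sigma})$, $j\in\mathbb{Z}$, form a Riesz system in $L_2(\mathbb{R})$: there are $a,b>0$ such that for every $\beta\in\ell_2(\mathbb{Z})$ the series $\sum_{j\in\mathbb{Z}}\beta_jB(\cdot-\frac{j\pi}{\sigma})$ converges in $L_2(\mathbb{R})$ and $$a\|\beta\|_{\ell_2(\mathbb{Z})}^2\leqslant\Big\|\sum_{j\in\mathbb{Z}}\beta_jB\big(\cdot-\tfrac{j\pi}{\sigma}\big)\Big\|_{L_2(\mathbb{R})}^2\leqslant b\|\beta\|_{\ell_2(\mathbb{Z})}^2 .$$ For $s=\sum_{j\in\mathbb{Z}}\beta_jB(\cdot-\frac{j\pi}{\sigma})$ with $\beta\in\ell_2(\mathbb{Z})$ (the sequence $\beta$ is determined by $s$) put $$\zeta_{B,\sigma}(s,y)=\sum_{j\in\mathbb{Z}}\beta_je^{-i\frac{j\pi}{\sigma}y}\quad\text{(convergence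 in } L_2[-\sigma,\sigma]),$$ and let $\mathbb{S}_{B,\sigma,\rho}$ be the set of all such $s$ with $\zeta_{B,\sigma}(s,y)=0$ for a.e. $y$ with $\rho<|y|\leqslant\sigma$ (no condition if $\rho=\sigma$). Let $$D_{B,\sigma}(y)=\sum_{\nu\in\mathbb{Z}}\big|\widehat{B}(y+2\nu\sigma)\big|^2,$$ where $\widehat{f}$ is the Fourier transform on $L_2(\mathbb{R})$ normalized by $\widehat{f}(y)=\frac{1}{2\pi}\int_{\mathbb{R}}f(x)e^{-ixy}\,dx$ for $f\in L_1(\mathbb{R})\cap L_2(\mathbb{R})$. Then for all $S,s\in\mathbb{S}_{B,\sigma,\rho}$ $$\int_{\mathbb{R}}|s(x)|^2\,dx=2\pi\int_{-\rho}^{\rho}|\zeta_{B,\sigma}(s,y)|^2D_{B,\sigma}(y)\,dy,$$ $$\int_{\mathbb{R}}S(x)\overline{s(x)}\,dx=2\pi\int_{-\rho}^{\rho}\zeta_{B,\sigma}(S,y)\overline{\zeta_{B,\sigma}(s,y)}D_{B,\sigma}(y)\,dy,$$ where the integrands on the right-hand sides are integrable on $[-\rho,\rho]$. -/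

import Mathlib

open MeasureTheory Set
open scoped FourierTransform ENNReal lp

noncomputable section

namespace ShiftSpaces

/-- The two-sided sequence space `ℓ₂(ℤ)` over the scalar field `𝕜`. -/
abbrev EllTwo (𝕜 : Type*) [RCLike 𝕜] : Type _ := lp (fun _ : ℤ => 𝕜) 2

/-- The space `L₂(ℝ)` of `𝕜`-valued functions (`𝕜` is the real or the complex field). -/
abbrev LTwo (𝕜 : Type*) [RCLike 𝕜] : Type _ := Lp 𝕜 2 (volume : Measure ℝ)

/-- The space `L₂[-σ, σ]` of complex-valued functions. -/
abbrev LTwoIcc (σ : ℝ) : Type _ := Lp ℂ 2 (volume.restrict (Icc (-σ) σ) : Measure ℝ)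

/-- A Riesz system in a Hilbert space: there are `a, b > 0` such that for every `β ∈ ℓ₂(ℤ)` the
series `∑ β_j f_j` converges and `a ‖β‖² ≤ ‖∑ β_j f_j‖² ≤ b ‖β‖²`. -/
def IsRieszSystem (𝕜 : Type*) [RCLike 𝕜] {H : Type*} [NormedAddCommGroup H]
    [InnerProductSpace 𝕜 H] (f : ℤ → H) : Prop :=
  ∃ a b : ℝ, 0 < a ∧ 0 < b ∧ ∀ β : EllTwo 𝕜,
    Summable (fun j : ℤ => β j • f j) ∧
      a * ‖β‖ ^ 2 ≤ ‖∑' j : ℤ, β j • f j‖ ^ 2 ∧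
      ‖∑' j : ℤ, β j • f j‖ ^ 2 ≤ b * ‖β‖ ^ 2

/-- The translate `f (· - h)` of `f ∈ L₂(ℝ)`. -/
def translate {𝕜 : Type*} [RCLike 𝕜] (h : ℝ) (f : LTwo 𝕜) : LTwo 𝕜 :=
  Lp.compMeasurePreserving (fun x : ℝ => x - h) (measurePreserving_sub_right volume h) f

/-- The equidistant shifts `B (· - j π / σ)`, `j ∈ ℤ`. -/
def shifts {𝕜 : Type*} [RCLike 𝕜] (B : LTwo 𝕜) (σ : ℝ) (j : ℤ) : LTwo 𝕜 :=
  translate (j * Real.pi / σ) B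

/-- The Fourier transform on `L₂(ℝ)` with the normalization
`f̂ (y) = (1 / 2π) ∫ f x * exp (-i x y) dx`. Mathlib's `𝓕` has the kernel `exp (-2π i x ξ)`, hence
the rescaling. A real function is first regarded as a complex one. -/
def fourierHat {𝕜 : Type*} [RCLike 𝕜] (f : LTwo 𝕜) (y : ℝ) : ℂ :=
  (1 / (2 * Real.pi) : ℂ) *
    (𝓕 ((RCLike.map 𝕜 ℂ).compLp f : LTwo ℂ) : LTwo ℂ) (y / (2 * Real.pi))

/-- `D_{B,σ}(y) = ∑_{ν ∈ ℤ} |B̂ (y + 2 ν σ)|²`. -/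
def weightD {𝕜 : Type*} [RCLike 𝕜] (B : LTwo 𝕜) (σ y : ℝ) : ℝ :=
  ∑' ν : ℤ, ‖fourierHat B (y + 2 * ν * σ)‖ ^ 2

lemma memLp_expo (σ : ℝ) (j : ℤ) :
    MemLp (fun y : ℝ => Complex.exp (-(Complex.I * (j * Real.pi / σ) * y))) 2
      (volume.restrict (Icc (-σ) σ)) := by
  refine MemLp.of_bound (C := 1) ?_ ?_
  · exact (by fun_prop : Continuous fun y : ℝ =>
      Complex.exp (-(Complex.I * (j * Real.pi / σ) * y))).aestronglyMeasurable
  · refine Filter.Eventually.of_forall fun y => ?_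
    rw [Complex.norm_exp]
    have h : (-(Complex.I * (j * Real.pi / σ) * y) : ℂ)
        = ((-(j * Real.pi / σ * y) : ℝ) : ℂ) * Complex.I := by
      push_cast; ring
    rw [h, Complex.re_ofReal_mul]
    simp

/-- The function `y ↦ exp (-i (j π / σ) y)` as an element of `L₂[-σ, σ]`. -/
def expo (σ : ℝ) (j : ℤ) : LTwoIcc σ := (memLp_expo σ j).toLp _

/-- The series `∑_j β_j exp (-i (j π / σ) y)`, summed in `L₂[-σ, σ]`
(it converges by `hasSum_trigSeries` below). -/
def trigSeries {𝕜 : Type*} [RCLike 𝕜] (σ : ℝ) (β : EllTwo 𝕜) : LTwoIcc σ :=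
  ∑' j : ℤ, (RCLike.map 𝕜 ℂ (β j)) • expo σ j

/-- `s` has the representation `s = ∑_j β_j B (· - j π / σ)` in `L₂(ℝ)`, where `β ∈ ℓ₂(ℤ)`. -/
def IsRepr {𝕜 : Type*} [RCLike 𝕜] (B : LTwo 𝕜) (σ : ℝ) (s : LTwo 𝕜) (β : EllTwo 𝕜) : Prop :=
  HasSum (fun j : ℤ => β j • shifts B σ j) s

/-- The space `𝕊_{B,σ,ρ}`: all `s = ∑_j β_j B (· - j π / σ)` with `β ∈ ℓ₂(ℤ)` and
`∑_j β_j exp (-i (j π / σ) y) = 0` for almost every `y` with `ρ < |y| ≤ σ`.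
For `ρ = σ` the last condition is void. -/
def shiftSpace {𝕜 : Type*} [RCLike 𝕜] (B : LTwo 𝕜) (σ ρ : ℝ) : Set (LTwo 𝕜) :=
  {s | ∃ β : EllTwo 𝕜, IsRepr B σ s β ∧
    ∀ᵐ y : ℝ, ρ < |y| → |y| ≤ σ → trigSeries σ β y = 0}

open Classical in
/-- The coefficient sequence of `s` with respect to the shifts of `B` (it is unique if the shifts
form a Riesz system, see `coeff_eq`; the value is `0` if `s` has no representation). -/
def coeff {𝕜 : Type*} [RCLike 𝕜] (B : LTwo 𝕜) (σ : ℝ) (s : LTwo 𝕜) : EllTwo 𝕜 :=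
  if h : ∃ β : EllTwo 𝕜, IsRepr B σ s β then h.choose else 0

/-- `ζ_{B,σ}(s, ·) = ∑_j β_j exp (-i (j π / σ) ·) ∈ L₂[-σ, σ]` for
`s = ∑_j β_j B (· - j π / σ)`. -/
def zeta {𝕜 : Type*} [RCLike 𝕜] (B : LTwo 𝕜) (σ : ℝ) (s : LTwo 𝕜) : LTwoIcc σ :=
  trigSeries σ (coeff B σ s)

/-- The coefficients in a Riesz system of shifts are unique, so `coeff` and `zeta` are the
intended objects. -/
lemma coeff_eq {𝕜 : Type*} [RCLike 𝕜] {B : LTwo 𝕜} {σ : ℝ}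
    (hB : IsRieszSystem 𝕜 (shifts B σ)) {s : LTwo 𝕜} {β : EllTwo 𝕜} (hβ : IsRepr B σ s β) :
    coeff B σ s = β := by
  have hex : ∃ β : EllTwo 𝕜, IsRepr B σ s β := ⟨β, hβ⟩
  have h1 : IsRepr B σ s (coeff B σ s) := by
    unfold coeff
    rw [dif_pos hex]
    exact hex.choose_spec
  obtain ⟨a, b, ha, -, h⟩ := hB
  have h2 : HasSum (fun j : ℤ => (coeff B σ s - β) j • shifts B σ j) 0 := by
    have := HasSum.sub h1 hβ
    rw [sub_self] at this
    refine this.congr_fun ?_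
    intro j
    simp [sub_smul]
  have h3 := (h (coeff B σ s - β)).2.1
  rw [h2.tsum_eq] at h3
  have h4 : ‖coeff B σ s - β‖ ^ 2 ≤ 0 := by
    by_contra hc
    push Not at hc
    have := mul_pos ha hc
    norm_num at h3
    linarith
  have h5 : ‖coeff B σ s - β‖ = 0 := by
    exact pow_eq_zero_iff (two_ne_zero) |>.1 (le_antisymm h4 (sq_nonneg _))
  exact sub_eq_zero.1 (norm_eq_zero.1 h5)

lemma inner_expo {σ : ℝ} (hσ : 0 < σ) (j k : ℤ) :
    inner ℂ (expo σ j) (expo σ k) = if j = k then (2 * σ : ℂ) else 0 := by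
  have hσ' : (σ : ℂ) ≠ 0 := by exact_mod_cast hσ.ne'
  have hpi : (Real.pi : ℂ) ≠ 0 := by exact_mod_cast Real.pi_ne_zero
  rw [L2.inner_def]
  have h1 : ∀ᵐ y : ℝ ∂(volume.restrict (Icc (-σ) σ)), inner ℂ (expo σ j y) (expo σ k y)
      = Complex.exp ((Complex.I * ((j - k : ℂ) * Real.pi / σ)) * y) := by
    filter_upwards [(memLp_expo σ j).coeFn_toLp, (memLp_expo σ k).coeFn_toLp] with y hj hk
    simp only [expo]
    rw [hj, hk, RCLike.inner_apply, ← Complex.exp_conj, ← Complex.exp_add]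
    congr 1
    simp
    ring
  rw [integral_congr_ae h1, integral_Icc_eq_integral_Ioc,
    ← intervalIntegral.integral_of_le (by linarith)]
  split_ifs with h
  · subst h
    simp
    ring
  · have hjk : (j - k : ℂ) ≠ 0 := by
      rw [sub_ne_zero]; exact_mod_cast h
    have hc : (Complex.I * ((j - k : ℂ) * Real.pi / σ)) ≠ 0 := by
      simp [hjk, hσ', Complex.I_ne_zero]
    rw [integral_exp_mul_complex hc]
    have e1 : Complex.exp (Complex.I * ((j - k : ℂ) * Real.pi / σ) * (σ : ℝ))
        = Complex.exp (Complex.I * ((j - k : ℂ) * Real.pi / σ) * ((-σ : ℝ) : ℂ)) := by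
      rw [Complex.exp_eq_exp_iff_exists_int]
      refine ⟨j - k, ?_⟩
      push_cast
      field_simp
      ring
    rw [e1, sub_self, zero_div]

/-- The series defining `trigSeries` converges in `L₂[-σ, σ]`. -/
lemma hasSum_trigSeries {𝕜 : Type*} [RCLike 𝕜] {σ : ℝ} (hσ : 0 < σ) (β : EllTwo 𝕜) :
    HasSum (fun j : ℤ => (RCLike.map 𝕜 ℂ (β j)) • expo σ j) (trigSeries σ β) := by
  refine Summable.hasSum ?_
  set c : ℝ := Real.sqrt (2 * σ) with hc
  have hc0 : 0 < c := Real.sqrt_pos.2 (by linarith)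
  have hcc : (c : ℂ) * c = 2 * σ := by
    rw [← Complex.ofReal_mul, hc, Real.mul_self_sqrt (by linarith)]; push_cast; ring
  have hcne : (c : ℂ) ≠ 0 := by exact_mod_cast hc0.ne'
  have hort : Orthonormal ℂ (fun j : ℤ => ((c : ℂ)⁻¹) • expo σ j) := by
    rw [orthonormal_iff_ite]
    intro j k
    rw [inner_smul_left, inner_smul_right, inner_expo hσ, ← hcc]
    split_ifs <;> simp [hcne]
  have hfam := hort.orthogonalFamily
  have hnorm : ∀ z : 𝕜, ‖RCLike.map 𝕜 ℂ z‖ = ‖z‖ := by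
    intro z
    have h : ‖RCLike.map 𝕜 ℂ z‖ ^ 2 = ‖z‖ ^ 2 := by
      rw [RCLike.norm_sq_eq_def, RCLike.norm_sq_eq_def (z := z)]
      simp [RCLike.map_apply]
    exact (pow_left_inj₀ (norm_nonneg _) (norm_nonneg _) two_ne_zero).1 h
  have hs := (hfam.summable_iff_norm_sq_summable
    (fun j => (c : ℂ) * RCLike.map 𝕜 ℂ (β j))).2 (by
      have hβ : Summable fun j : ℤ => ‖β j‖ ^ 2 := by
        have := (lp.memℓp β).summable (by norm_num)
        simpa using this
      simp only [norm_mul, hnorm, mul_pow]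
      exact hβ.mul_left _)
  refine hs.congr fun j => ?_
  simp only [LinearIsometry.toSpanSingleton_apply, smul_smul]
  congr 1
  field_simp

/-- The series defining `weightD` converges at almost every point. -/
lemma summable_weightD {𝕜 : Type*} [RCLike 𝕜] (B : LTwo 𝕜) {σ : ℝ} (hσ : 0 < σ) :
    ∀ᵐ y : ℝ, Summable fun ν : ℤ => ‖fourierHat B (y + 2 * ν * σ)‖ ^ 2 := by
  have hint : Integrable fun y : ℝ => ‖fourierHat B y‖ ^ 2 := by
    have h1 := (Lp.memLp (𝓕 ((RCLike.map 𝕜 ℂ).compLp B : LTwo ℂ) : LTwo ℂ)).integrable_norm_pow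
      two_ne_zero
    have h2 := (h1.comp_div (R := 2 * Real.pi) (by positivity)).const_mul
      (‖(1 / (2 * Real.pi) : ℂ)‖ ^ 2)
    refine h2.congr (Filter.Eventually.of_forall fun y => ?_)
    simp only [fourierHat, norm_mul, mul_pow]
  set f : ℝ → ℝ := fun y => ‖fourierHat B y‖ ^ 2 with hf
  have hf0 : ∀ y, 0 ≤ f y := fun y => sq_nonneg _
  have hT : 0 < 2 * σ := by linarith
  have key : ∀ a : ℝ, ∀ᵐ y ∂(volume.restrict (Ioc a (a + 2 * σ))),
      Summable fun ν : ℤ => f (y + 2 * ν * σ) := by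
    intro a
    have hU : ⋃ ν : ℤ, Ioc (a + ν • (2 * σ)) (a + (ν + 1) • (2 * σ)) = univ :=
      iUnion_Ioc_add_zsmul hT a
    have hd := pairwise_disjoint_Ioc_add_zsmul a (2 * σ)
    have e1 : ∫⁻ y, ENNReal.ofReal (f y) =
        ∑' ν : ℤ, ∫⁻ y in Ioc a (a + 2 * σ), ENNReal.ofReal (f (y + 2 * ν * σ)) := by
      rw [← setLIntegral_univ, ← hU, lintegral_iUnion (fun _ => measurableSet_Ioc) hd]
      refine tsum_congr fun ν => ?_
      have hmp := measurePreserving_add_right (volume : Measure ℝ) (2 * ν * σ)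
      rw [← hmp.setLIntegral_comp_preimage_emb (measurableEmbedding_addRight _)]
      congr 2
      ext y
      simp only [mem_preimage, mem_Ioc, zsmul_eq_mul]
      push_cast
      constructor <;> rintro ⟨h1, h2⟩ <;> constructor <;> linarith
    have hm : ∀ ν : ℤ, AEMeasurable (fun y => ENNReal.ofReal (f (y + 2 * ν * σ)))
        (volume.restrict (Ioc a (a + 2 * σ))) := fun ν =>
      ((hint.comp_add_right (2 * ν * σ)).aestronglyMeasurable.aemeasurable.ennreal_ofReal).restrict
    rw [← lintegral_tsum hm] at e1
    have hfin : ∫⁻ y in Ioc a (a + 2 * σ),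
        ∑' ν : ℤ, ENNReal.ofReal (f (y + 2 * ν * σ)) ≠ ∞ := by
      rw [← e1]
      exact hint.lintegral_lt_top.ne
    filter_upwards [ae_lt_top' (AEMeasurable.tsum hm) hfin] with y hy
    have := ENNReal.summable_toReal hy.ne
    simpa only [ENNReal.toReal_ofReal (hf0 _)] using this
  have hall : ∀ᵐ y ∂(volume.restrict (⋃ ν : ℤ, Ioc (0 + ν • (2 * σ)) (0 + (ν + 1) • (2 * σ)))),
      Summable fun ν : ℤ => f (y + 2 * ν * σ) := by
    rw [ae_restrict_iUnion_iff]
    intro ν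
    have h := key (0 + ν • (2 * σ))
    rwa [show 0 + ν • (2 * σ) + 2 * σ = 0 + (ν + 1) • (2 * σ) by rw [add_smul, one_smul]; ring] at h
  rwa [iUnion_Ioc_add_zsmul hT, Measure.restrict_univ] at hall

end ShiftSpaces

end

noncomputable section

namespace ShiftSpaces

open Filter Topology

/-! The Fourier transform turns the shift by `jπ/σ` into multiplication by `exp (-i (jπ/σ) y)`,
which is `2σ`-periodic. Hence the transform of `s` is the periodic extension of `ζ(s, ·)` times that
of `B` (`fourierHat_of_isRepr`). Plancherel (`integral_fourierHat`) moves the inner product to the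
Fourier side. Cutting the line into periods (`integral_periodization`) leaves `ζ(S) * conj ζ(s)` as
a common factor, and the remaining sum over periods is `D`. Membership in the space then shrinks
`[-σ, σ]` to `[-ρ, ρ]`. The Riesz condition enters through uniqueness of coefficients (`coeff_eq`),
and the norm formula is the case `S = s`. -/

/-- Two families converging in `L^p` along the same countably generated filter converge almost
everywhere along a common sequence. -/
lemma exists_seq_tendsto_ae_pair {α α' E E' ι : Type*} [MeasurableSpace α] [MeasurableSpace α']
    [NormedAddCommGroup E] [NormedAddCommGroup E'] {μ : Measure α} {ν : Measure α'}
    {p q : ℝ≥0∞} [Fact (1 ≤ p)] [Fact (1 ≤ q)]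
    {l : Filter ι} [l.NeBot] [l.IsCountablyGenerated] {u : ι → Lp E p μ} {v : ι → Lp E' q ν}
    {u₀ : Lp E p μ} {v₀ : Lp E' q ν} (hu : Tendsto u l (𝓝 u₀)) (hv : Tendsto v l (𝓝 v₀)) :
    ∃ ns : ℕ → ι, Tendsto ns atTop l ∧
      (∀ᵐ x ∂μ, Tendsto (fun n => u (ns n) x) atTop (𝓝 (u₀ x))) ∧
      ∀ᵐ x ∂ν, Tendsto (fun n => v (ns n) x) atTop (𝓝 (v₀ x)) := by
  obtain ⟨ns, h1, h1'⟩ := (tendstoInMeasure_of_tendsto_Lp hu).exists_seq_tendsto_ae'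
  -- The second extraction refines the first, so convergence of `u` survives.
  obtain ⟨ms, h2, h2'⟩ := (tendstoInMeasure_of_tendsto_Lp (hv.comp h1)).exists_seq_tendsto_ae'
  refine ⟨ns ∘ ms, h1.comp h2, ?_, h2'⟩
  filter_upwards [h1'] with x hx using hx.comp h2

/-! ### Translation and modulation -/

/-- The Fourier transform of a translate of a Schwartz function. -/
lemma fourier_translate_toLp (h : ℝ) (f : SchwartzMap ℝ ℂ) :
    ∀ᵐ ξ : ℝ, (𝓕 (translate h (f.toLp 2) : LTwo ℂ) : LTwo ℂ) ξ =
      Complex.exp (-(2 * Real.pi * Complex.I * h * ξ)) * (𝓕 (f.toLp 2 : LTwo ℂ) : LTwo ℂ) ξ := by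
  have hg : (fun x : ℝ => x - h).HasTemperateGrowth := by fun_prop
  have hg' : AntilipschitzWith 1 (fun x : ℝ => x - h) :=
    (Isometry.of_dist_eq fun x y => by simp).antilipschitz
  set g : SchwartzMap ℝ ℂ := SchwartzMap.compCLMOfAntilipschitz ℂ hg hg' f with hgdef
  have e : (translate h (f.toLp 2) : LTwo ℂ) = g.toLp 2 := by
    refine Lp.ext ?_
    have h1 := Lp.coeFn_compMeasurePreserving (f.toLp 2 : LTwo ℂ)
      (measurePreserving_sub_right volume h)
    have h2 := (measurePreserving_sub_right volume h).quasiMeasurePreserving.ae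
      (f.coeFn_toLp 2 volume)
    filter_upwards [h1, h2, g.coeFn_toLp 2 volume] with x a b c
    rw [c, translate, a, Function.comp, b]
    rfl
  -- For Schwartz functions the `L₂` transform is given by the integral, where a change of variables
  -- applies.
  rw [e, SchwartzMap.toLp_fourier_eq, SchwartzMap.toLp_fourier_eq]
  filter_upwards [(𝓕 g).coeFn_toLp 2 volume, (𝓕 f).coeFn_toLp 2 volume] with ξ a b
  rw [a, b, SchwartzMap.fourier_coe, SchwartzMap.fourier_coe]
  have h3 : (g : ℝ → ℂ) = (f : ℝ → ℂ) ∘ fun v => v + -h := by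
    ext x; simp [hgdef, sub_eq_add_neg]
  have h4 := congrFun (Fourier.fourierIntegral_comp_add_right Real.fourierChar volume f (-h)) ξ
  rw [Real.fourier_real_eq, Real.fourier_real_eq, h3]
  simp only [Fourier.fourierIntegral_def] at h4
  rw [h4, Circle.smul_def, smul_eq_mul, Real.fourierChar_apply]
  congr 2
  push_cast
  ring

/-- The Fourier transform turns translations into modulations. -/
lemma fourier_translate (h : ℝ) (f : LTwo ℂ) :
    ∀ᵐ ξ : ℝ, (𝓕 (translate h f : LTwo ℂ) : LTwo ℂ) ξ =
      Complex.exp (-(2 * Real.pi * Complex.I * h * ξ)) * (𝓕 f : LTwo ℂ) ξ := by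
  have hd : DenseRange (SchwartzMap.toLpCLM ℂ (E := ℝ) ℂ 2 volume) :=
    SchwartzMap.denseRange_toLpCLM ENNReal.ofNat_ne_top
  -- Schwartz functions approaching `f` in `L₂`; density makes this filter nontrivial. Both sides
  -- pass to the limit a.e. along one common sequence.
  set l := comap (SchwartzMap.toLpCLM ℂ (E := ℝ) ℂ 2 volume) (𝓝 f)
  have : l.NeBot := comap_neBot fun t ht => hd.mem_nhds ht
  have hl : Tendsto (fun g : SchwartzMap ℝ ℂ => (g.toLp 2 : LTwo ℂ)) l (𝓝 f) := tendsto_comap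
  have hF : Continuous (fun g : LTwo ℂ => (𝓕 g : LTwo ℂ)) := FourierTransform.continuous_fourier
  have hT : Continuous (fun g : LTwo ℂ => translate h g) :=
    (Lp.isometry_compMeasurePreserving (measurePreserving_sub_right volume h)).continuous
  obtain ⟨ns, -, h1, h2⟩ := exists_seq_tendsto_ae_pair
    (((hF.comp hT).tendsto f).comp hl) ((hF.tendsto f).comp hl)
  filter_upwards [h1, h2, ae_all_iff.2 fun n => fourier_translate_toLp h (ns n)] with ξ a b c
  refine tendsto_nhds_unique a ?_
  exact (b.const_mul _).congr fun n => (c n).symm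

/-! ### Periodization -/

/-- The integral over the line is the integral of the periodization over a period. -/
lemma integral_periodization {f : ℝ → ℂ} (hf : Integrable f) {σ : ℝ} (hσ : 0 < σ) :
    IntegrableOn (fun y => ∑' ν : ℤ, f (y + 2 * ν * σ)) (Ioc (-σ) σ) ∧
      ∫ y in Ioc (-σ) σ, ∑' ν : ℤ, f (y + 2 * ν * σ) = ∫ x, f x := by
  have hT : 0 < 2 * σ := by linarith
  have hU : ⋃ ν : ℤ, Ioc (-σ + ν • (2 * σ)) (-σ + (ν + 1) • (2 * σ)) = univ :=
    iUnion_Ioc_add_zsmul hT (-σ)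
  have hd := pairwise_disjoint_Ioc_add_zsmul (-σ) (2 * σ)
  have hpre : ∀ ν : ℤ, (fun y : ℝ => y + 2 * ν * σ) ⁻¹'
      Ioc (-σ + ν • (2 * σ)) (-σ + (ν + 1) • (2 * σ)) = Ioc (-σ) σ := by
    intro ν
    ext y
    simp only [mem_preimage, mem_Ioc, zsmul_eq_mul]
    push_cast
    constructor <;> rintro ⟨h1, h2⟩ <;> constructor <;> linarith
  have hmp : ∀ ν : ℤ, MeasurePreserving (fun y : ℝ => y + 2 * ν * σ) volume volume :=
    fun ν => measurePreserving_add_right volume _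
  have hemb : ∀ ν : ℤ, MeasurableEmbedding (fun y : ℝ => y + 2 * ν * σ) :=
    fun ν => measurableEmbedding_addRight _
  have hm : ∀ ν : ℤ, AEStronglyMeasurable (fun y => f (y + 2 * ν * σ))
      (volume.restrict (Ioc (-σ) σ)) :=
    fun ν => (hf.comp_add_right (2 * ν * σ)).aestronglyMeasurable.restrict
  -- This identity gives both integrability of the periodization and the interchange of sum and
  -- integral.
  have hsum : ∑' ν : ℤ, ∫⁻ y in Ioc (-σ) σ, ‖f (y + 2 * ν * σ)‖ₑ = ∫⁻ x, ‖f x‖ₑ := by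
    rw [← setLIntegral_univ (fun x => ‖f x‖ₑ), ← hU,
      lintegral_iUnion (fun _ => measurableSet_Ioc) hd]
    refine tsum_congr fun ν => ?_
    rw [← hpre ν]
    exact (hmp ν).setLIntegral_comp_preimage_emb (hemb ν) (fun x => ‖f x‖ₑ) _
  refine ⟨⟨(AEMeasurable.tsum fun ν => (hm ν).aemeasurable).aestronglyMeasurable, ?_⟩, ?_⟩
  · refine lt_of_le_of_lt (lintegral_mono fun y => enorm_tsum_le_tsum_enorm) ?_
    rw [lintegral_tsum fun ν => (hm ν).enorm, hsum]
    exact hf.2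
  · rw [integral_tsum hm (by rw [hsum]; exact hf.2.ne), ← setIntegral_univ (f := f), ← hU]
    rw [← (hasSum_integral_iUnion (fun _ => measurableSet_Ioc) hd hf.integrableOn).tsum_eq]
    refine tsum_congr fun ν => ?_
    rw [← hpre ν]
    exact (hmp ν).setIntegral_preimage_emb (hemb ν) f _

/-! ### Complexification and Plancherel -/

section Scalars

variable {𝕜 : Type*} [RCLike 𝕜]

lemma rclikeMap_mul (z w : 𝕜) :
    RCLike.map 𝕜 ℂ (z * w) = RCLike.map 𝕜 ℂ z * RCLike.map 𝕜 ℂ w := by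
  apply Complex.ext <;> simp [RCLike.map_apply]

lemma rclikeMap_conj (z : 𝕜) :
    RCLike.map 𝕜 ℂ (starRingEnd 𝕜 z) = starRingEnd ℂ (RCLike.map 𝕜 ℂ z) := by
  apply Complex.ext <;> simp [RCLike.map_apply]

lemma rclikeMap_ofReal (r : ℝ) : RCLike.map 𝕜 ℂ (r : 𝕜) = r := by
  apply Complex.ext <;> simp [RCLike.map_apply]

/-- The product of two functions in `L₂` is integrable. -/
lemma integrable_mul_conj (S s : LTwo 𝕜) : Integrable fun x => S x * starRingEnd 𝕜 (s x) := by
  refine (L2.integrable_inner s S).congr (Eventually.of_forall fun x => ?_)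
  simp [RCLike.inner_apply]

/-- Regarding functions as complex valued preserves the inner product. -/
lemma integral_complexify (S s : LTwo 𝕜) :
    RCLike.map 𝕜 ℂ (∫ x : ℝ, S x * starRingEnd 𝕜 (s x)) =
      inner ℂ ((RCLike.map 𝕜 ℂ).compLp s : LTwo ℂ) ((RCLike.map 𝕜 ℂ).compLp S : LTwo ℂ) := by
  rw [← ContinuousLinearMap.integral_comp_comm _ (integrable_mul_conj S s), L2.inner_def]
  refine integral_congr_ae ?_
  filter_upwards [(RCLike.map 𝕜 ℂ).coeFn_compLp S, (RCLike.map 𝕜 ℂ).coeFn_compLp s] with x a b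
  rw [a, b, rclikeMap_mul, rclikeMap_conj, RCLike.inner_apply]

/-- Plancherel's formula for `fourierHat`. -/
lemma integral_fourierHat (S s : LTwo 𝕜) :
    Integrable (fun y => fourierHat S y * starRingEnd ℂ (fourierHat s y)) ∧
      RCLike.map 𝕜 ℂ (∫ x : ℝ, S x * starRingEnd 𝕜 (s x)) =
        2 * Real.pi * ∫ y, fourierHat S y * starRingEnd ℂ (fourierHat s y) := by
  set F : LTwo ℂ := 𝓕 ((RCLike.map 𝕜 ℂ).compLp S : LTwo ℂ)
  set G : LTwo ℂ := 𝓕 ((RCLike.map 𝕜 ℂ).compLp s : LTwo ℂ)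
  have hpi : (Real.pi : ℂ) ≠ 0 := by exact_mod_cast Real.pi_ne_zero
  have e : (fun y => fourierHat S y * starRingEnd ℂ (fourierHat s y)) = fun y : ℝ =>
      (1 / (2 * Real.pi) : ℂ) ^ 2 *
        (fun ξ => F ξ * starRingEnd ℂ (G ξ)) (y / (2 * Real.pi)) := by
    ext y
    simp only [fourierHat, map_mul, map_div₀, map_one, Complex.conj_ofReal, map_ofNat]
    ring
  rw [e]
  refine ⟨((integrable_mul_conj F G).comp_div (by positivity)).const_mul _, ?_⟩
  -- Two factors `1/(2π)` from the normalization and a Jacobian `2π` leave `1/(2π)`, which the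
  -- prefactor `2π` cancels.
  rw [integral_const_mul, Measure.integral_comp_div (fun ξ => F ξ * starRingEnd ℂ (G ξ)), integral_complexify,
    ← Lp.inner_fourier_eq, L2.inner_def, abs_of_pos (by positivity : (0 : ℝ) < 2 * Real.pi)]
  simp only [RCLike.inner_apply, Complex.real_smul]
  push_cast
  field_simp
  rfl

/-- Carries a.e. statements about `𝓕` over to `fourierHat`, whose argument is rescaled. -/
lemma quasiMeasurePreserving_div_two_pi :
    Measure.QuasiMeasurePreserving (fun y : ℝ => y / (2 * Real.pi)) volume volume := by
  have := Measure.quasiMeasurePreserving_smul (volume : Measure ℝ)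
    (r := (2 * Real.pi)⁻¹) (by positivity)
  simpa only [smul_eq_mul, div_eq_inv_mul] using this

/-! ### Fourier transform of series of shifts -/

/-- The Fourier transform of a single scaled shift. -/
lemma fourier_smul_shifts (B : LTwo 𝕜) (σ : ℝ) (c : 𝕜) (j : ℤ) :
    ∀ᵐ y : ℝ, fourierHat (c • shifts B σ j) y = RCLike.map 𝕜 ℂ c *
      Complex.exp (-(Complex.I * (j * Real.pi / σ) * y)) * fourierHat B y := by
  have e : ((RCLike.map 𝕜 ℂ).compLp (c • shifts B σ j) : LTwo ℂ) =
      (RCLike.map 𝕜 ℂ c) • translate (j * Real.pi / σ) ((RCLike.map 𝕜 ℂ).compLp B) := by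
    have hmp := measurePreserving_sub_right (volume : Measure ℝ) (j * Real.pi / σ)
    refine Lp.ext ?_
    filter_upwards [(RCLike.map 𝕜 ℂ).coeFn_compLp (c • shifts B σ j),
      Lp.coeFn_smul c (shifts B σ j),
      Lp.coeFn_smul (RCLike.map 𝕜 ℂ c)
        (translate (j * Real.pi / σ) ((RCLike.map 𝕜 ℂ).compLp B : LTwo ℂ)),
      Lp.coeFn_compMeasurePreserving B hmp,
      Lp.coeFn_compMeasurePreserving ((RCLike.map 𝕜 ℂ).compLp B : LTwo ℂ) hmp,
      hmp.quasiMeasurePreserving.ae ((RCLike.map 𝕜 ℂ).coeFn_compLp B)] with x h1 h2 h3 h4 h5 h6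
    rw [h1, h2, h3, Pi.smul_apply, Pi.smul_apply, translate, h5, Function.comp, h6, shifts,
      translate, h4, Function.comp, smul_eq_mul, smul_eq_mul, rclikeMap_mul]
  have hpi : (Real.pi : ℂ) ≠ 0 := by exact_mod_cast Real.pi_ne_zero
  filter_upwards [quasiMeasurePreserving_div_two_pi.ae (fourier_translate (j * Real.pi / σ) ((RCLike.map 𝕜 ℂ).compLp B : LTwo ℂ)),
    quasiMeasurePreserving_div_two_pi.ae (Lp.coeFn_smul (RCLike.map 𝕜 ℂ c)
      (𝓕 (translate (j * Real.pi / σ) ((RCLike.map 𝕜 ℂ).compLp B : LTwo ℂ)) : LTwo ℂ))] with y h1 h2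
  rw [fourierHat, e, FourierTransform.fourier_smul, h2, Pi.smul_apply, h1, fourierHat, smul_eq_mul]
  have : (-(2 * Real.pi * Complex.I * (j * Real.pi / σ : ℝ) * (y / (2 * Real.pi) : ℝ)) : ℂ)
      = -(Complex.I * (j * Real.pi / σ) * y) := by
    push_cast
    field_simp
  rw [this]
  ring

/-- The Fourier transform of a finite combination of shifts. -/
lemma fourierHat_sum_shifts (B : LTwo 𝕜) (σ : ℝ) (β : EllTwo 𝕜) (t : Finset ℤ) :
    ∀ᵐ y : ℝ, fourierHat (∑ j ∈ t, β j • shifts B σ j) y = (∑ j ∈ t, RCLike.map 𝕜 ℂ (β j) *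
      Complex.exp (-(Complex.I * (j * Real.pi / σ) * y))) * fourierHat B y := by
  have e : (𝓕 ((RCLike.map 𝕜 ℂ).compLp (∑ j ∈ t, β j • shifts B σ j) : LTwo ℂ) : LTwo ℂ) =
      ∑ j ∈ t, 𝓕 ((RCLike.map 𝕜 ℂ).compLp (β j • shifts B σ j) : LTwo ℂ) := by
    have h := map_sum ((RCLike.map 𝕜 ℂ).compLpL 2 (volume : Measure ℝ))
      (fun j => β j • shifts B σ j) t
    have h' := map_sum (Lp.fourierTransformₗᵢ ℝ ℂ)
      (fun j => ((RCLike.map 𝕜 ℂ).compLp (β j • shifts B σ j) : LTwo ℂ)) t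
    exact (congrArg (fun g : LTwo ℂ => (𝓕 g : LTwo ℂ)) h).trans h'
  filter_upwards [quasiMeasurePreserving_div_two_pi.ae (Lp.coeFn_fun_finsetSum t
      fun j => (𝓕 ((RCLike.map 𝕜 ℂ).compLp (β j • shifts B σ j) : LTwo ℂ) : LTwo ℂ)),
    ae_all_iff.2 fun j => fourier_smul_shifts B σ (β j) j] with y h1 h2
  rw [fourierHat, e, h1, Finset.mul_sum, Finset.sum_mul]
  exact Finset.sum_congr rfl fun j _ => h2 j

/-- The Fourier transform of `∑_j β_j B (· - j π / σ)` is the product of the periodic extension of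
`∑_j β_j exp (-i (j π / σ) ·)` and the Fourier transform of `B`. -/
lemma fourierHat_of_isRepr {B : LTwo 𝕜} {σ : ℝ} (hσ : 0 < σ) {s : LTwo 𝕜} {β : EllTwo 𝕜}
    (hβ : IsRepr B σ s β) :
    ∀ᵐ y ∂(volume.restrict (Icc (-σ) σ)), ∀ ν : ℤ, fourierHat s (y + 2 * ν * σ) =
      trigSeries σ β y * fourierHat B (y + 2 * ν * σ) := by
  have hσ' : (σ : ℂ) ≠ 0 := by exact_mod_cast hσ.ne'
  have hC : Continuous fun f : LTwo 𝕜 =>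
      (𝓕 ((RCLike.map 𝕜 ℂ).compLp f : LTwo ℂ) : LTwo ℂ) :=
    (FourierTransform.continuous_fourier (E := LTwo ℂ) (F := LTwo ℂ)).comp
      ((RCLike.map 𝕜 ℂ).compLpL 2 (volume : Measure ℝ)).continuous
  have hu : Tendsto (fun t : Finset ℤ => ∑ j ∈ t, β j • shifts B σ j) atTop (𝓝 s) := hβ
  have hv : Tendsto (fun t : Finset ℤ => ∑ j ∈ t, (RCLike.map 𝕜 ℂ (β j)) • expo σ j) atTop
      (𝓝 (trigSeries σ β)) := hasSum_trigSeries hσ β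
  -- The same finite partial sums must converge a.e. for the transform of `s` on the line and for
  -- the trigonometric series on `[-σ, σ]`, so that their limits can be compared.
  obtain ⟨ns, -, h1, h2⟩ := exists_seq_tendsto_ae_pair ((hC.tendsto s).comp hu) hv
  have h3 : ∀ᵐ y : ℝ, Tendsto (fun n => (∑ j ∈ ns n, RCLike.map 𝕜 ℂ (β j) *
      Complex.exp (-(Complex.I * (j * Real.pi / σ) * y))) * fourierHat B y) atTop
      (𝓝 (fourierHat s y)) := by
    filter_upwards [quasiMeasurePreserving_div_two_pi.ae h1,
      ae_all_iff.2 fun n => fourierHat_sum_shifts B σ β (ns n)] with y a b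
    exact (a.const_mul _).congr fun n => b n
  have h4 : ∀ᵐ y : ℝ, ∀ ν : ℤ, Tendsto (fun n => (∑ j ∈ ns n, RCLike.map 𝕜 ℂ (β j) *
      Complex.exp (-(Complex.I * (j * Real.pi / σ) * y))) * fourierHat B (y + 2 * ν * σ)) atTop
      (𝓝 (fourierHat s (y + 2 * ν * σ))) := by
    refine ae_all_iff.2 fun ν => ?_
    filter_upwards [(measurePreserving_add_right volume
      (2 * ν * σ)).quasiMeasurePreserving.ae h3] with y hy
    refine hy.congr fun n => ?_
    congr 1
    refine Finset.sum_congr rfl fun j _ => ?_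
    congr 1
    rw [Complex.exp_eq_exp_iff_exists_int]
    -- Moving `y` by `2νσ` changes the exponent by `-2πi jν`.
    refine ⟨-(j * ν), ?_⟩
    push_cast
    field_simp
    ring
  have h5 : ∀ᵐ y ∂(volume.restrict (Icc (-σ) σ)), ∀ n,
      (∑ j ∈ ns n, (RCLike.map 𝕜 ℂ (β j)) • expo σ j : LTwoIcc σ) y = ∑ j ∈ ns n,
        RCLike.map 𝕜 ℂ (β j) * Complex.exp (-(Complex.I * (j * Real.pi / σ) * y)) := by
    refine ae_all_iff.2 fun n => ?_
    filter_upwards [Lp.coeFn_fun_finsetSum (ns n) fun j => (RCLike.map 𝕜 ℂ (β j)) • expo σ j,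
      ae_all_iff.2 fun j => Lp.coeFn_smul (RCLike.map 𝕜 ℂ (β j)) (expo σ j),
      ae_all_iff.2 fun j => (memLp_expo σ j).coeFn_toLp] with y a b c
    rw [a]
    refine Finset.sum_congr rfl fun j _ => ?_
    rw [b, Pi.smul_apply, smul_eq_mul, expo, c]
  filter_upwards [h2, ae_restrict_of_ae h4, h5] with y a b c ν
  refine tendsto_nhds_unique (b ν) ((a.mul_const _).congr fun n => ?_)
  rw [c n]

/-! ### Parseval's formulas -/

/-- Members of the shift space are represented by their coefficient sequence. -/
lemma isRepr_coeff {B : LTwo 𝕜} {σ ρ : ℝ} (hB : IsRieszSystem 𝕜 (shifts B σ)) {s : LTwo 𝕜}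
    (hs : s ∈ shiftSpace B σ ρ) :
    IsRepr B σ s (coeff B σ s) ∧ ∀ᵐ y : ℝ, ρ < |y| → |y| ≤ σ → zeta B σ s y = 0 := by
  obtain ⟨β, h1, h2⟩ := hs
  rw [zeta, coeff_eq hB h1]
  exact ⟨h1, h2⟩

/-- Parseval's formula for the inner product in the shift space. -/
lemma integral_mul_conj_shiftSpace {σ ρ : ℝ} (hρ : 0 < ρ) (hρσ : ρ ≤ σ) {B : LTwo 𝕜}
    (hB : IsRieszSystem 𝕜 (shifts B σ)) {S s : LTwo 𝕜}
    (hS : S ∈ shiftSpace B σ ρ) (hs : s ∈ shiftSpace B σ ρ) :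
    IntervalIntegrable
        (fun y => zeta B σ S y * starRingEnd ℂ (zeta B σ s y) * (weightD B σ y : ℂ))
        volume (-ρ) ρ ∧
      RCLike.map 𝕜 ℂ (∫ x : ℝ, S x * starRingEnd 𝕜 (s x)) = 2 * Real.pi *
        ∫ y in (-ρ)..ρ, zeta B σ S y * starRingEnd ℂ (zeta B σ s y) * (weightD B σ y : ℂ) := by
  have hσ : 0 < σ := hρ.trans_le hρσ
  obtain ⟨hS1, hS2⟩ := isRepr_coeff hB hS
  obtain ⟨hs1, -⟩ := isRepr_coeff hB hs
  obtain ⟨hint, hpl⟩ := integral_fourierHat S s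
  obtain ⟨hper, hpe⟩ := integral_periodization hint hσ
  have hsub : Ioc (-ρ) ρ ⊆ Ioc (-σ) σ := Ioc_subset_Ioc (by linarith) hρσ
  have hae : (fun y => ∑' ν : ℤ, fourierHat S (y + 2 * ν * σ) *
        starRingEnd ℂ (fourierHat s (y + 2 * ν * σ))) =ᵐ[volume.restrict (Ioc (-σ) σ)]
      fun y => zeta B σ S y * starRingEnd ℂ (zeta B σ s y) * (weightD B σ y : ℂ) := by
    filter_upwards [ae_restrict_of_ae_restrict_of_subset Ioc_subset_Icc_self
        (fourierHat_of_isRepr hσ hS1),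
      ae_restrict_of_ae_restrict_of_subset Ioc_subset_Icc_self
        (fourierHat_of_isRepr hσ hs1)] with y a b
    -- Both rewrites hold without summability, so convergence of `D` at `y` need not be checked.
    rw [weightD, Complex.ofReal_tsum, ← tsum_mul_left]
    refine tsum_congr fun ν => ?_
    rw [a, b, map_mul, Complex.ofReal_pow, ← Complex.mul_conj', zeta, zeta]
    ring
  have hg := hper.congr_fun_ae hae
  refine ⟨(intervalIntegrable_iff_integrableOn_Ioc_of_le (by linarith)).2 (hg.mono_set hsub), ?_⟩
  rw [hpl, ← hpe, integral_congr_ae hae, intervalIntegral.integral_of_le (by linarith)]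
  congr 1
  refine setIntegral_eq_of_subset_of_ae_sdiff_eq_zero
    measurableSet_Ioc.nullMeasurableSet hsub ?_
  -- Vanishing of `ζ(S)` alone kills the product. The point `-ρ` lies outside `Ioc (-ρ) ρ` but does
  -- not satisfy `ρ < |y|`, so it is discarded as a null set.
  filter_upwards [hS2, Measure.ae_ne volume (-ρ)] with y h1 h2 h3
  obtain ⟨⟨h4, h5⟩, h6⟩ := h3
  have h7 : ρ < |y| := by
    by_contra! h
    obtain ⟨h8, h9⟩ := abs_le.1 h
    exact h6 ⟨lt_of_le_of_ne h8 h2.symm, h9⟩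
  rw [h1 h7 (abs_le.2 ⟨h4.le, h5⟩), zero_mul, zero_mul]

/-- Parseval's formula for the norm in the shift space. -/
lemma integral_norm_sq_shiftSpace {σ ρ : ℝ} (hρ : 0 < ρ) (hρσ : ρ ≤ σ) {B : LTwo 𝕜}
    (hB : IsRieszSystem 𝕜 (shifts B σ)) {s : LTwo 𝕜} (hs : s ∈ shiftSpace B σ ρ) :
    IntervalIntegrable (fun y => ‖zeta B σ s y‖ ^ 2 * weightD B σ y) volume (-ρ) ρ ∧
      ∫ x : ℝ, ‖s x‖ ^ 2 =
        2 * Real.pi * ∫ y in (-ρ)..ρ, ‖zeta B σ s y‖ ^ 2 * weightD B σ y := by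
  obtain ⟨h1, h2⟩ := integral_mul_conj_shiftSpace hρ hρσ hB hs hs
  have e1 : (fun y => zeta B σ s y * starRingEnd ℂ (zeta B σ s y) * (weightD B σ y : ℂ)) =
      fun y => ((‖zeta B σ s y‖ ^ 2 * weightD B σ y : ℝ) : ℂ) := by
    ext y
    rw [Complex.mul_conj']
    push_cast
    rfl
  have e2 : (fun x => s x * starRingEnd 𝕜 (s x)) = fun x => ((‖s x‖ ^ 2 : ℝ) : 𝕜) := by
    ext x
    rw [RCLike.mul_conj]
    push_cast
    rfl
  rw [e1] at h1 h2
  rw [e2, integral_ofReal, rclikeMap_ofReal, intervalIntegral.integral_ofReal] at h2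
  refine ⟨⟨?_, ?_⟩, by exact_mod_cast h2⟩
  · exact h1.1.re
  · exact h1.2.re

end Scalars

end ShiftSpaces

end

theorem theorem1 {𝕜 : Type*} [RCLike 𝕜] (σ ρ : ℝ) (hρ : 0 < ρ) (hρσ : ρ ≤ σ)
    (B : ShiftSpaces.LTwo 𝕜) (hB : ShiftSpaces.IsRieszSystem 𝕜 (ShiftSpaces.shifts B σ))
    (S s : ShiftSpaces.LTwo 𝕜)
    (hS : S ∈ ShiftSpaces.shiftSpace B σ ρ) (hs : s ∈ ShiftSpaces.shiftSpace B σ ρ) :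
    (IntervalIntegrable
        (fun y => ‖ShiftSpaces.zeta B σ s y‖ ^ 2 * ShiftSpaces.weightD B σ y) volume (-ρ) ρ ∧
      ∫ x : ℝ, ‖s x‖ ^ 2 =
        2 * Real.pi *
          ∫ y in (-ρ)..ρ, ‖ShiftSpaces.zeta B σ s y‖ ^ 2 * ShiftSpaces.weightD B σ y) ∧
    (IntervalIntegrable
        (fun y => ShiftSpaces.zeta B σ S y * (starRingEnd ℂ) (ShiftSpaces.zeta B σ s y) *
          (ShiftSpaces.weightD B σ y : ℂ)) volume (-ρ) ρ ∧
      RCLike.map 𝕜 ℂ (∫ x : ℝ, S x * (starRingEnd 𝕜) (s x)) =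
        2 * Real.pi *
          ∫ y in (-ρ)..ρ, ShiftSpaces.zeta B σ S y * (starRingEnd ℂ) (ShiftSpaces.zeta B σ s y) *
            (ShiftSpaces.weightD B σ y : ℂ)) := by
  exact ⟨ShiftSpaces.integral_norm_sq_shiftSpace hρ hρσ hB hs,
    ShiftSpaces.integral_mul_conj_shiftSpace hρ hρσ hB hS hs⟩
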